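/- **Setting.** Let $r\ge 1$ and $d,s,c\ge 0$ be integers, and let $h_0=w_0=1$ and $h_1,w_1,\dots,h_r,w_r$ be natural numbers. Put $E_i=\mathbb R^{h_i\times w_i\times d}$ with the entrywise $\ell_p$ norm $\|\cdot\|$, where $p\in[1,\infty]$ is fixed. View $X\in E_i$ also as an $(h_iw_i)\times d$ matrix whose rows are the tokens. *Up-interpolation layers.* An up-interpolation layer is either the identity of $\mathbb R^{1\times1\times d}$, or, for positive integers $h<h'$, $w<w'$ and a bicubic spline kernel $W$ (a piecewise cubic function $\mathbb R\to[0,1]$ with finitely many breakpoints), the map $\mathbb R^{h\times w\times d}\to\mathbb R^{h'\times w'\times d}$, $$Y_{i,j,l}=\sum_{a=-1}^{2}\sum_{b=-1}^{2}W(a)\,X_{\lfloor ih/h'\rfloor+a,\ \lfloor jw/w'\rfloor+b,\ l}\,W(b),$$ where indices outside $\{1,\dots,h\}$, $\{1,\dots,w\}$ are moved to the nearest border. *One-layer, single-head transformers.* A feed-forward layer with $c$ neurons maps every token $x$ to $x+W_2\,\mathrm{ReLU}(W_1x+b_1)+b_2$ with $W_1\in\mathbb R^{c\times d}$, $b_1\in\mathbb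 R^c$, $W_2\in\mathbb R^{d\times c}$, $b_2\in\mathbb R^d$. A single-head attention sublayer of head size $s$ is $X\mapsto D^{-1}AXW_VW_O$ (respectively $X\mapsto X+D^{-1}AXW_VW_O$, with skip connection), where $A_{ij}=\exp(X_{i,*}W_QW_K^{\top}X_{j,*}^{\top})$, $D=\mathrm{diag}(A\mathbf 1)$, $W_Q,W_K,W_V\in\mathbb R^{d\times s}$, $W_O\in\mathbb R^{s\times d}$. Fix whether skip connections are used. Let $\mathcal T$ be the class of all maps $E_i\to E_i$ that consist of exactly one such attention sublayer, preceded and followed by finitely many feed-forward layers with $c$ neurons. (The case with skip connection and $s=1$, $c=4$ is the class $\mathcal T^{1,1,4}_A$.) A *VAR Transformer* with $r$ layers is a map $\tau_{\mathsf{VAR}}=\tau_r\circ\Phi_r\circ\cdots\circ\tau_1\circ\Phi_1:E_0\to E_r$ in which $\Phi_i:E_{i-1}\to E_i$ are up-interpolation layers and $\tau_i:E_i\to E_i$ belong to $\mathcal T$. **Theorem.** Let $g_i:E_{i-1}\to E_i$ and $f_i:E_i\to E_i$ $(1\le i\le r)$ be $K$-Lipschitz and let $$f_{\mathrm{word2img}}=f_r\circ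 g_r\circ\cdots\circ f_1\circ g_1:E_0\to E_r .$$ Let $f_i$ be $K_{1,i}$-Lipschitz, and let $K_2>2$ be such that every $f_i\circ g_i$ is $K_2$-Lipschitz. Suppose that for each $i$ some up-interpolation layer $\Phi_i:E_{i-1}\to E_i$ satisfies $\|g_i(X)-\Phi_i(X)\|\le\epsilon_{1,i}$ for all $X$. 1. Let $\epsilon_{2,i}$ be such that some $\tau_i\in\mathcal T$ satisfies $\|f_i(X)-\tau_i(X)\|\le\epsilon_{2,i}$ for all $X\in E_i$. Then there is a VAR Transformer $\tau_{\mathsf{VAR}}$ with $$\|\tau_{\mathsf{VAR}}(x)-f_{\mathrm{word2img}}(x)\|\le K_2^{\,r}\max_{1\le i\le r}\bigl(K_{1,i}\,\epsilon_{1,i}+\epsilon_{2,i}\bigr)\qquad\text{for all }x\in E_0 .$$ 2. Let $\epsilon_{2,i}$ be such that for each compact $C\subset E_i$ some $\tau_i\in\mathcal T$ satisfies $\|f_i(X)-\tau_i(X)\|\le\epsilon_{2,i}$ for all $X\in C$. Then for every compact $\Omega\subset E_0$ there is a VAR Transformer $\tau_{\mathsf{VAR}}$ for which the same bound holds for all $x\in\Omega$.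 -/

import Mathlib

open scoped NNReal ENNReal Matrix

noncomputable section

namespace VAR

/-- Token maps `X ∈ ℝ^{h × w × d}`, normed by the entrywise `ℓ_p` norm. -/
abbrev TokenMap (p : ℝ≥0∞) (h w d : ℕ) : Type :=
  PiLp p (fun _ : Fin h × Fin w × Fin d => ℝ)

/-- The matrix version of a token map: the two spatial dimensions are merged into one index of
size `h * w`, so that every row is a token in `ℝ^d`. -/
def toMat {p : ℝ≥0∞} {h w d : ℕ} (X : TokenMap p h w d) : Matrix (Fin h × Fin w) (Fin d) ℝ :=
  Matrix.of fun k l => X (k.1, k.2, l)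

/-- The tensorization of a matrix whose rows are indexed by the `h * w` positions. -/
def ofMat (p : ℝ≥0∞) {h w d : ℕ} (M : Matrix (Fin h × Fin w) (Fin d) ℝ) : TokenMap p h w d :=
  WithLp.toLp p fun q => M (q.1, q.2.1) q.2.2

/-! ### Up-interpolation -/

/-- A bicubic spline kernel: a piecewise cubic function with values in `[0,1]`.
Piecewise cubic means: off a finite set of breakpoints, `W` is on every interval a polynomial
of degree at most three. -/
structure IsBicubicKernel (W : ℝ → ℝ) : Prop where
  piecewise_cubic : ∃ B : Finset ℝ, ∀ I : Set ℝ, I.OrdConnected → Disjoint I (B : Set ℝ) →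
    ∃ q : Polynomial ℝ, q.natDegree ≤ 3 ∧ ∀ x ∈ I, W x = q.eval x
  mem_Icc : ∀ x, W x ∈ Set.Icc (0 : ℝ) 1

/-- The row (or column) of a source of size `n` that has the one-based number `z`; numbers outside
`1, …, n` are moved to the nearest border (replicated border). -/
def clampIdx {n : ℕ} (hn : 0 < n) (z : ℤ) : Fin n :=
  ⟨(z - 1).toNat ⊓ (n - 1), by omega⟩

/-- One-step up-interpolation `ℝ^{h × w × d} → ℝ^{h' × w' × d}` with kernel `W`:
`Y_{i,j,l} = ∑_{s=-1}^{2} ∑_{t=-1}^{2} W(s) · X_{⌊i h / h'⌋ + s, ⌊j w / w'⌋ + t, l} · W(t)`,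
where `i ∈ {1,…,h'}` and `j ∈ {1,…,w'}` (elements of `Fin` are zero-based, whence the `+ 1`). -/
def upInterp (p : ℝ≥0∞) {h w : ℕ} (h' w' d : ℕ) (hh : 0 < h) (hw : 0 < w) (W : ℝ → ℝ)
    (X : TokenMap p h w d) : TokenMap p h' w' d :=
  WithLp.toLp p fun q =>
    ∑ s ∈ Finset.Icc (-1 : ℤ) 2, ∑ t ∈ Finset.Icc (-1 : ℤ) 2,
      W s *
        X (clampIdx hh (((((q.1 : ℕ) + 1) * h / h' : ℕ) : ℤ) + s),
          clampIdx hw (((((q.2.1 : ℕ) + 1) * w / w' : ℕ) : ℤ) + t), q.2.2) *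
        W t

/-- Up-interpolation layers: the first one is the identity of `ℝ^{1 × 1 × d}`; every other one
is a one-step up-interpolation, with some bicubic kernel, to a strictly larger height and width. -/
inductive IsUpLayer (p : ℝ≥0∞) (d : ℕ) :
    ∀ {h w h' w' : ℕ}, (TokenMap p h w d → TokenMap p h' w' d) → Prop
  | first : IsUpLayer p d (fun X : TokenMap p 1 1 d => X)
  | interp {h w h' w' : ℕ} (hh : 0 < h) (hw : 0 < w) (hlt : h < h') (wlt : w < w')
      (W : ℝ → ℝ) (hW : IsBicubicKernel W) :
      IsUpLayer p d (upInterp p h' w' d hh hw W)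

/-! ### One-layer, single-head transformers -/

/-- Single-head softmax attention with head size `s`: `D⁻¹ A X W_V W_O`, where
`A_{i,j} = exp (X_{i,*} W_Q W_Kᵀ X_{j,*}ᵀ)` and `D = diag (A 1)`. -/
def attention {ι : Type} [Fintype ι] [DecidableEq ι] {d s : ℕ}
    (WQ WK WV : Matrix (Fin d) (Fin s) ℝ) (WO : Matrix (Fin s) (Fin d) ℝ)
    (X : Matrix ι (Fin d) ℝ) : Matrix ι (Fin d) ℝ :=
  let A : Matrix ι ι ℝ := Matrix.of fun i j => Real.exp ((X * WQ * WKᵀ * Xᵀ) i j)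
  Matrix.diagonal (fun i => (∑ j, A i j)⁻¹) * A * X * WV * WO

/-- The attention sublayer, with (`skip = true`) or without (`skip = false`) skip connection. -/
def attentionLayer (skip : Bool) {ι : Type} [Fintype ι] [DecidableEq ι] {d s : ℕ}
    (WQ WK WV : Matrix (Fin d) (Fin s) ℝ) (WO : Matrix (Fin s) (Fin d) ℝ)
    (X : Matrix ι (Fin d) ℝ) : Matrix ι (Fin d) ℝ :=
  (if skip then X else 0) + attention WQ WK WV WO X

/-- The token-wise feed-forward layer `x ↦ x + W₂ ReLU (W₁ x + b₁) + b₂` with `c` neurons. -/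
def ffn {ι : Type} {c d : ℕ} (W₁ : Matrix (Fin c) (Fin d) ℝ) (b₁ : Fin c → ℝ)
    (W₂ : Matrix (Fin d) (Fin c) ℝ) (b₂ : Fin d → ℝ)
    (X : Matrix ι (Fin d) ℝ) : Matrix ι (Fin d) ℝ :=
  Matrix.of fun k => X k + W₂ *ᵥ (fun a => max 0 ((W₁ *ᵥ X k + b₁) a)) + b₂

/-- Compositions of finitely many feed-forward layers with `c` neurons each. -/
inductive IsFFNStack (ι : Type) (c d : ℕ) : (Matrix ι (Fin d) ℝ → Matrix ι (Fin d) ℝ) → Prop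
  | nil : IsFFNStack ι c d id
  | cons (W₁ : Matrix (Fin c) (Fin d) ℝ) (b₁ : Fin c → ℝ) (W₂ : Matrix (Fin d) (Fin c) ℝ)
      (b₂ : Fin d → ℝ) {F : Matrix ι (Fin d) ℝ → Matrix ι (Fin d) ℝ}
      (hF : IsFFNStack ι c d F) : IsFFNStack ι c d (ffn W₁ b₁ W₂ b₂ ∘ F)

/-- One-layer single-head transformers on `ℝ^{h × w × d}`: exactly one attention sublayer, of head
size `s`, preceded and followed by finitely many feed-forward layers with `c` neurons. -/
def IsOneLayerTransformer (skip : Bool) (s c : ℕ) {p : ℝ≥0∞} {h w d : ℕ}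
    (τ : TokenMap p h w d → TokenMap p h w d) : Prop :=
  ∃ (F G : Matrix (Fin h × Fin w) (Fin d) ℝ → Matrix (Fin h × Fin w) (Fin d) ℝ)
    (WQ WK WV : Matrix (Fin d) (Fin s) ℝ) (WO : Matrix (Fin s) (Fin d) ℝ),
    IsFFNStack (Fin h × Fin w) c d F ∧ IsFFNStack (Fin h × Fin w) c d G ∧
      ∀ X, τ X = ofMat p (G (attentionLayer skip WQ WK WV WO (F (toMat X))))

/-! ### Compositions of layers -/

/-- `f_r ∘ g_r ∘ ⋯ ∘ f_1 ∘ g_1`; here `f i`, `g i` are the maps numbered `i + 1`. -/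
def layerComp {E : ℕ → Type} (g : ∀ i, E i → E (i + 1)) (f : ∀ i, E (i + 1) → E (i + 1)) :
    ∀ r, E 0 → E r
  | 0 => id
  | r + 1 => f r ∘ g r ∘ layerComp g f r

/-- VAR Transformers with `r` layers on the scales `h 0 × w 0, …, h r × w r`:
maps `τ_r ∘ Φ_r ∘ ⋯ ∘ τ_1 ∘ Φ_1` with up-interpolation layers `Φ_i` and one-layer single-head
transformers `τ_i`. -/
def IsVARTransformer (skip : Bool) (s c : ℕ) {p : ℝ≥0∞} {d : ℕ} (h w : ℕ → ℕ) (r : ℕ)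
    (T : TokenMap p (h 0) (w 0) d → TokenMap p (h r) (w r) d) : Prop :=
  ∃ (Φ : ∀ i, TokenMap p (h i) (w i) d → TokenMap p (h (i + 1)) (w (i + 1)) d)
    (τ : ∀ i, TokenMap p (h (i + 1)) (w (i + 1)) d → TokenMap p (h (i + 1)) (w (i + 1)) d),
    (∀ i < r, IsUpLayer p d (Φ i)) ∧ (∀ i < r, IsOneLayerTransformer skip s c (τ i)) ∧
      T = layerComp (E := fun i => TokenMap p (h i) (w i) d) Φ τ r

end VAR

end

/-! Let `e_k` be the distance between the approximate point `Z` and the exact point `Y` after `k`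
layers. Splitting `τ(ΦZ) - f(gY)` at `f(ΦZ)` and `f(gZ)` gives `e_{k+1} ≤ ε₂ + K₁ ε₁ + K e_k ≤ δ + K
e_k` with `e_0 = 0`, hence `e_k ≤ (K^k - 1) δ` once `K ≥ 2` (`norm_layerComp_sub_le`). For compact
`Ω` the inputs of each `τ_i` must lie in a compact set known before `τ_i` is chosen. The error bound
itself supplies it: approximate trajectories stay within `K^r δ` of the exact ones, whatever the
`τ_i` are. -/

open Metric Bornology

namespace VAR

section LayerComp

variable {E : ℕ → Type} [∀ i, NormedAddCommGroup (E i)]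

/-- If every `f i ∘ g i` is `K`-Lipschitz, then `layerComp g f` is `K ^ k`-Lipschitz. -/
theorem lipschitzWith_layerComp {g : ∀ i, E i → E (i + 1)} {f : ∀ i, E (i + 1) → E (i + 1)}
    {K : ℝ≥0} {r : ℕ} (hfg : ∀ i < r, LipschitzWith K (f i ∘ g i)) :
    ∀ k ≤ r, LipschitzWith (K ^ k) (layerComp g f k)
  | 0, _ => by simpa [layerComp] using LipschitzWith.id
  | k + 1, hk => by
    rw [pow_succ']
    exact (hfg k hk).comp (lipschitzWith_layerComp hfg k (Nat.le_of_succ_le hk))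

/-- Error propagation through a composition of approximated layers: `τ i` has to approximate
`f i` only at the inputs that are reached from a neighbourhood of the exact trajectory. -/
theorem norm_layerComp_sub_le {g Φ : ∀ i, E i → E (i + 1)} {f τ : ∀ i, E (i + 1) → E (i + 1)}
    {K : ℝ≥0} {K₁ : ℕ → ℝ≥0} {ε₁ ε₂ : ℕ → ℝ} {δ : ℝ} {r : ℕ} (hK : 2 ≤ K) (hδ : 0 ≤ δ)
    (hf : ∀ i < r, LipschitzWith (K₁ i) (f i))
    (hfg : ∀ i < r, LipschitzWith K (f i ∘ g i))
    (hle : ∀ i < r, K₁ i * ε₁ i + ε₂ i ≤ δ)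
    (hΦ : ∀ i < r, ∀ X, ‖g i X - Φ i X‖ ≤ ε₁ i) (x : E 0)
    (hτ : ∀ i < r, ∀ Z, ‖Z - layerComp g f i x‖ ≤ (K : ℝ) ^ r * δ →
      ‖f i (Φ i Z) - τ i (Φ i Z)‖ ≤ ε₂ i) :
    ∀ k ≤ r, ‖layerComp Φ τ k x - layerComp g f k x‖ ≤ ((K : ℝ) ^ k - 1) * δ
  | 0, _ => by simp [layerComp]
  | k + 1, hk => by
    have hK' : (2 : ℝ) ≤ K := by exact_mod_cast hK
    have ih := norm_layerComp_sub_le hK hδ hf hfg hle hΦ x hτ k (Nat.le_of_succ_le hk)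
    set Z := layerComp Φ τ k x with hZ
    set Y := layerComp g f k x with hY
    -- A radius independent of `k`, so that `hτ` applies at `Z`.
    have hZY : ‖Z - Y‖ ≤ (K : ℝ) ^ r * δ := ih.trans <| by
      have : (K : ℝ) ^ k ≤ (K : ℝ) ^ r :=
        pow_le_pow_right₀ (by linarith) (Nat.le_of_succ_le hk)
      gcongr
      linarith
    have h₁ : ‖τ k (Φ k Z) - f k (Φ k Z)‖ ≤ ε₂ k := by
      rw [norm_sub_rev]
      exact hτ k hk Z hZY
    have h₂ : ‖f k (Φ k Z) - f k (g k Z)‖ ≤ K₁ k * ε₁ k :=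
      ((hf k hk).norm_sub_le _ _).trans <| by
        rw [norm_sub_rev]
        gcongr
        exact hΦ k hk Z
    have h₃ : ‖f k (g k Z) - f k (g k Y)‖ ≤ K * (((K : ℝ) ^ k - 1) * δ) :=
      ((hfg k hk).norm_sub_le _ _).trans (by gcongr)
    calc ‖τ k (Φ k Z) - f k (g k Y)‖
        ≤ ‖τ k (Φ k Z) - f k (Φ k Z)‖ + ‖f k (Φ k Z) - f k (g k Z)‖
            + ‖f k (g k Z) - f k (g k Y)‖ := by
          refine (norm_sub_le_norm_sub_add_norm_sub _ (f k (g k Z)) _).trans ?_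
          gcongr
          exact norm_sub_le_norm_sub_add_norm_sub _ _ _
      _ ≤ ε₂ k + K₁ k * ε₁ k + K * (((K : ℝ) ^ k - 1) * δ) := by gcongr
      -- `δ + K (K^k - 1) δ = (K^(k+1) - K + 1) δ`, and `K ≥ 2` makes `1 - K ≤ -1`.
      _ ≤ ((K : ℝ) ^ (k + 1) - 1) * δ := by
          rw [pow_succ']
          nlinarith [hle k hk, mul_nonneg (sub_nonneg.2 hK') hδ]

end LayerComp

/-- A map at bounded distance from a map with bounded image has bounded image. -/
theorem isBounded_image_of_norm_sub_le {α F : Type*} [SeminormedAddCommGroup F] {u v : α → F}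
    {S : Set α} {ε : ℝ} (hu : IsBounded (u '' S)) (h : ∀ x ∈ S, ‖u x - v x‖ ≤ ε) :
    IsBounded (v '' S) := by
  refine (hu.cthickening (δ := ε)).subset ?_
  rintro _ ⟨x, hx, rfl⟩
  refine mem_cthickening_of_dist_le _ (u x) _ _ ⟨x, hx, rfl⟩ ?_
  rw [dist_comm, dist_eq_norm]
  exact h x hx

end VAR

theorem theorem5p4
    (p : ℝ≥0∞) [Fact (1 ≤ p)] (skip : Bool) (s c d r : ℕ) (hr : 1 ≤ r)
    (h w : ℕ → ℕ) (h_zero : h 0 = 1) (w_zero : w 0 = 1)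
    (K K₂ : ℝ≥0) (K₁ : ℕ → ℝ≥0) (ε₁ ε₂ : ℕ → ℝ)
    (g : ∀ i, VAR.TokenMap p (h i) (w i) d → VAR.TokenMap p (h (i + 1)) (w (i + 1)) d)
    (f : ∀ i, VAR.TokenMap p (h (i + 1)) (w (i + 1)) d →
      VAR.TokenMap p (h (i + 1)) (w (i + 1)) d)
    (hg : ∀ i < r, LipschitzWith K (g i))
    (hf : ∀ i < r, LipschitzWith K (f i))
    (hK₁ : ∀ i < r, LipschitzWith (K₁ i) (f i))
    (hK₂ : 2 < K₂)
    (hK₂_lip : ∀ i < r, LipschitzWith K₂ (f i ∘ g i))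
    (hε₁ : ∀ i < r, ∃ Φ : VAR.TokenMap p (h i) (w i) d →
        VAR.TokenMap p (h (i + 1)) (w (i + 1)) d,
      VAR.IsUpLayer p d Φ ∧ ∀ X, ‖g i X - Φ X‖ ≤ ε₁ i) :
    -- errors measured by the supremum over the whole space
    ((∀ i < r, ∃ τ : VAR.TokenMap p (h (i + 1)) (w (i + 1)) d →
          VAR.TokenMap p (h (i + 1)) (w (i + 1)) d,
        VAR.IsOneLayerTransformer skip s c τ ∧ ∀ X, ‖f i X - τ X‖ ≤ ε₂ i) →
      ∃ T : VAR.TokenMap p (h 0) (w 0) d → VAR.TokenMap p (h r) (w r) d,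
        VAR.IsVARTransformer skip s c h w r T ∧
        ∀ x, ‖T x - VAR.layerComp (E := fun i => VAR.TokenMap p (h i) (w i) d) g f r x‖ ≤
          (K₂ : ℝ) ^ r * ⨆ i : Fin r, ((K₁ i : ℝ) * ε₁ i + ε₂ i)) ∧
    -- errors measured by the supremum over compact sets
    ((∀ i < r, ∀ C : Set (VAR.TokenMap p (h (i + 1)) (w (i + 1)) d), IsCompact C →
        ∃ τ : VAR.TokenMap p (h (i + 1)) (w (i + 1)) d →
          VAR.TokenMap p (h (i + 1)) (w (i + 1)) d,
        VAR.IsOneLayerTransformer skip s c τ ∧ ∀ X ∈ C, ‖f i X - τ X‖ ≤ ε₂ i) →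
      ∀ Ω : Set (VAR.TokenMap p (h 0) (w 0) d), IsCompact Ω →
        ∃ T : VAR.TokenMap p (h 0) (w 0) d → VAR.TokenMap p (h r) (w r) d,
          VAR.IsVARTransformer skip s c h w r T ∧
          ∀ x ∈ Ω, ‖T x - VAR.layerComp (E := fun i => VAR.TokenMap p (h i) (w i) d) g f r x‖ ≤
            (K₂ : ℝ) ^ r * ⨆ i : Fin r, ((K₁ i : ℝ) * ε₁ i + ε₂ i)) := by
  choose! Φ hΦ hgΦ using hε₁
  set δ : ℝ := ⨆ i : Fin r, ((K₁ i : ℝ) * ε₁ i + ε₂ i) with hδ_def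
  have hle : ∀ i < r, (K₁ i : ℝ) * ε₁ i + ε₂ i ≤ δ := fun i hi =>
    le_ciSup (f := fun i : Fin r => (K₁ i : ℝ) * ε₁ i + ε₂ i) (Set.finite_range _).bddAbove ⟨i, hi⟩
  have hε₁_nonneg : ∀ i < r, 0 ≤ ε₁ i := fun i hi => (norm_nonneg _).trans (hgΦ i hi 0)
  -- Since `r ≥ 1`, layer `0` exists and its term bounds `δ` from below.
  have hδ : (∀ i < r, 0 ≤ ε₂ i) → 0 ≤ δ := fun hε₂ =>
    (add_nonneg (mul_nonneg (K₁ 0).2 (hε₁_nonneg 0 hr)) (hε₂ 0 hr)).trans (hle 0 hr)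
  constructor
  · intro hε₂
    choose! τ hτ hfτ using hε₂
    have hδ := hδ fun i hi => (norm_nonneg _).trans (hfτ i hi 0)
    refine ⟨_, ⟨Φ, τ, hΦ, hτ, rfl⟩, fun x => ?_⟩
    exact (VAR.norm_layerComp_sub_le (E := fun i => VAR.TokenMap p (h i) (w i) d) hK₂.le hδ hK₁
      hK₂_lip hle hgΦ x (fun i hi Z _ => hfτ i hi (Φ i Z)) r le_rfl).trans (by linarith)
  · intro hε₂ Ω hΩ
    have hδ := hδ fun i hi => by
      -- Any nonempty compact set would show `0 ≤ ε₂ i`.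
      obtain ⟨τ, -, hfτ⟩ := hε₂ i hi {0} isCompact_singleton
      exact (norm_nonneg _).trans (hfτ 0 rfl)
    -- All inputs that can reach layer `i`; no `τ` enters this definition.
    let S : ∀ i, Set (VAR.TokenMap p (h i) (w i) d) := fun i =>
      cthickening ((K₂ : ℝ) ^ r * δ)
        (VAR.layerComp (E := fun i => VAR.TokenMap p (h i) (w i) d) g f i '' Ω)
    have hS : ∀ i < r, IsCompact (closure (Φ i '' S i)) := fun i hi => by
      have hSi : IsBounded (S i) := ((VAR.lipschitzWith_layerComp
        (E := fun i => VAR.TokenMap p (h i) (w i) d) hK₂_lip i hi.le).isBounded_image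
          hΩ.isBounded).cthickening
      have : ProperSpace (VAR.TokenMap p (h (i + 1)) (w (i + 1)) d) :=
        FiniteDimensional.proper_real _
      -- Continuity of `Φ i` is not needed: it stays within `ε₁ i` of the Lipschitz map `g i`, and
      -- bounded sets have compact closure in finite dimension.
      exact (VAR.isBounded_image_of_norm_sub_le ((hg i hi).isBounded_image hSi)
        fun X _ => hgΦ i hi X).isCompact_closure
    have hε₂ := fun i hi => hε₂ i hi _ (hS i hi)
    choose! τ hτ hfτ using hε₂
    refine ⟨_, ⟨Φ, τ, hΦ, hτ, rfl⟩, fun x hx => ?_⟩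
    refine (VAR.norm_layerComp_sub_le (E := fun i => VAR.TokenMap p (h i) (w i) d) hK₂.le hδ hK₁
      hK₂_lip hle hgΦ x (fun i hi Z hZ => ?_) r le_rfl).trans (by linarith)
    refine hfτ i hi _ (subset_closure ⟨Z, ?_, rfl⟩)
    exact mem_cthickening_of_dist_le _ _ _ _ ⟨x, hx, rfl⟩ (by rwa [dist_eq_norm])
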